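/- **Corollary (Energy theorem for the connection ring).** A finite abstract simplicial complex is a finite set of non-empty finite sets closed under taking non-empty subsets. Its elements $x$ are its cells, with $\dim x=|x|-1$. For two such complexes, or more generally two finite cell complexes built from them, $G\oplus H$ is the disjoint union, and $G\times H$ is the collection of set products $x\times y$, where $x$ is a cell of $G$, $y$ a cell of $H$ and $\dim(x\times y)=\dim x+\dim y$. Isomorphism classes of finite cell complexes form a commutative semiring under $\oplus$ and $\times$; the strong ring $R$ is the subring of its Grothendieck ring generated by the classes of finite abstract simplicial complexes. The Euler characteristic $\chi(G)=\sum_x(-1)^{\dim x}$ (sum over the cells of $G$) extends to a ring homomorphism $\chi:R\to\mathbb{Z}$. The connection graph of a finite cell complex $G$ has the cells of $G$ as vertices, two distinct cells being adjacent if they intersect; its connection Laplacian is $L(G)=1+A$, where $A$ is the adjacency matrix of the connection graph. For complexes $P,N$ that are finite disjoint unions of finite products of simplicial complexes, the signed complex $G=P\oplus(-N)$ represents $[P]-[N]\in R$, its negative is $-G=N\oplus(-P)$, and its connection Laplacian is the block diagonal matrix $L(G)=L(P)\oplus(-L(N))$. Let $r\in R$. Then $r$ is represented by some signed complex $G=P\oplus(-N)$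 of this kind, and for every such $G$ representing $r$ the following hold. 1. The integer matrix $L(G)$ is unimodular: $\det L(G)\in\{1,-1\}$. 2. The total energy equals the Euler characteristic: $\sum_{x,y}\big(L(G)^{-1}\big)_{xy}=\chi(r)$, where $x,y$ run over all cells of $G$. 3. $-G$ represents $-r$, and $L(-G)=-L(G)$ up to the evident reordering of the cells. -/

import Mathlib

namespace Algebra.GrothendieckAddGroup

/-! ### The Grothendieck ring of a commutative semiring -/

variable {M : Type*} [CommSemiring M]

theorem lift_of {G : Type*} [AddCommGroup G] (f : M →+ G) (a : M) : lift f (of a) = f a :=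
  DFunLike.congr_fun (lift.symm_apply_apply f) a

theorem lift_add {G : Type*} [AddCommGroup G] (f g : M →+ G) : lift (f + g) = lift f + lift g :=
  lift.symm.injective (by
    rw [Equiv.symm_apply_apply]
    ext a
    exact (congrArg₂ (· + ·) (lift_of f a) (lift_of g a)).symm)

/-- The biadditive extension of the multiplication of `M` to its additive Grothendieck group. -/
noncomputable def mulHom :
    GrothendieckAddGroup M →+ GrothendieckAddGroup M →+ GrothendieckAddGroup M :=
  lift
    { toFun := fun a => lift ((of (M := M)).comp (AddMonoidHom.mulLeft a))
      map_zero' := by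
        apply lift.symm.injective
        ext b
        simp [lift_symm_apply]
      map_add' := fun a a' => by
        rw [← lift_add]
        congr 1
        ext b
        exact (congrArg of (add_mul a a' b)).trans (map_add of _ _) }

theorem mulHom_of (a b : M) : mulHom (of a) (of b) = of (a * b) := by
  rw [mulHom, lift_of]
  exact lift_of _ b

theorem exists_eq_sub (x : GrothendieckAddGroup M) : ∃ a b : M, x = of a - of b := by
  induction x using AddLocalization.ind with
  | H y =>
    obtain ⟨a, b, hb⟩ := y
    refine ⟨a, b, ?_⟩
    rw [eq_sub_iff_add_eq]
    have hof : ∀ m : M, (of m : GrothendieckAddGroup M) = AddLocalization.mk m 0 := fun m =>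
      (AddLocalization.mk_zero_eq_addMonoidOf_mk m).symm
    rw [hof, hof]
    refine (AddLocalization.mk_add _ _ _ _).trans ?_
    rw [AddLocalization.mk_eq_mk_iff, AddLocalization.r_iff_exists]
    exact ⟨0, by simp [add_comm]⟩

noncomputable instance instMulOfSemiring : Mul (GrothendieckAddGroup M) :=
  ⟨fun x y => mulHom x y⟩

noncomputable instance instOneOfSemiring : One (GrothendieckAddGroup M) :=
  ⟨of 1⟩

noncomputable instance instNonUnitalNonAssocRingOfSemiring :
    NonUnitalNonAssocRing (GrothendieckAddGroup M) :=
  { (inferInstance : AddCommGroup (GrothendieckAddGroup M)), instMulOfSemiring (M := M) with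
    left_distrib := fun x y z => map_add (mulHom x) y z
    right_distrib := fun x y z => by
      change mulHom (x + y) z = mulHom x z + mulHom y z
      rw [map_add, AddMonoidHom.add_apply]
    zero_mul := fun x => by
      change mulHom 0 x = 0
      rw [map_zero, AddMonoidHom.zero_apply]
    mul_zero := fun x => map_zero (mulHom x) }

theorem of_mul_of (a b : M) : (of a * of b : GrothendieckAddGroup M) = of (a * b) :=
  mulHom_of a b

/-- The Grothendieck group of the additive monoid of a commutative semiring is a commutative
ring, with `of a * of b = of (a * b)`. -/
noncomputable instance instCommRingOfSemiring : CommRing (GrothendieckAddGroup M) :=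
  { instNonUnitalNonAssocRingOfSemiring (M := M), instOneOfSemiring (M := M) with
    mul_assoc := fun x y z => by
      obtain ⟨a, b, rfl⟩ := exists_eq_sub x
      obtain ⟨c, d, rfl⟩ := exists_eq_sub y
      obtain ⟨e, f, rfl⟩ := exists_eq_sub z
      simp only [mul_sub, sub_mul, of_mul_of, mul_assoc]
    one_mul := fun x => by
      obtain ⟨a, b, rfl⟩ := exists_eq_sub x
      change of 1 * _ = _
      simp only [mul_sub, of_mul_of, one_mul]
    mul_one := fun x => by
      obtain ⟨a, b, rfl⟩ := exists_eq_sub x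
      change _ * of 1 = _
      simp only [sub_mul, of_mul_of, mul_one]
    mul_comm := fun x y => by
      obtain ⟨a, b, rfl⟩ := exists_eq_sub x
      obtain ⟨c, d, rfl⟩ := exists_eq_sub y
      simp only [mul_sub, sub_mul, of_mul_of, mul_comm]
      abel }

/-- A semiring homomorphism to a commutative ring extends to the Grothendieck ring. -/
noncomputable def liftRingHom {S : Type*} [CommRing S] (f : M →+* S) :
    GrothendieckAddGroup M →+* S :=
  { lift f.toAddMonoidHom with
    map_one' := by
      change lift f.toAddMonoidHom (of 1) = 1
      rw [lift_of]
      exact map_one f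
    map_mul' := fun x y => by
      change lift f.toAddMonoidHom (x * y) =
        lift f.toAddMonoidHom x * lift f.toAddMonoidHom y
      obtain ⟨a, b, rfl⟩ := exists_eq_sub x
      obtain ⟨c, d, rfl⟩ := exists_eq_sub y
      simp only [mul_sub, sub_mul, of_mul_of, map_sub, lift_of]
      simp }

end Algebra.GrothendieckAddGroup

/-! ### Finite cell complexes -/

/-- A finite set of nonempty finite sets (the supports of the cells) on the vertex set which they
cover.  Each cell carries its dimension: for a simplex this is the number of vertices minus one,
while the product cell `x × y` has dimension `dim x + dim y`. -/
structure CellComplex : Type 1 where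
  Vert : Type
  Cell : Type
  fintypeCell : Fintype Cell
  support : Cell → Finset Vert
  dim : Cell → ℕ
  support_nonempty : ∀ c, (support c).Nonempty
  support_injective : Function.Injective support
  exists_mem_support : ∀ v, ∃ c, v ∈ support c

namespace CellComplex

attribute [instance] CellComplex.fintypeCell

/-- Isomorphism: a bijection of the vertices which induces a dimension preserving bijection of the
cells. -/
def Isomorphic (X Y : CellComplex) : Prop :=
  ∃ (f : X.Vert ≃ Y.Vert) (e : X.Cell ≃ Y.Cell),
    (∀ c v, f v ∈ Y.support (e c) ↔ v ∈ X.support c) ∧ ∀ c, Y.dim (e c) = X.dim c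

instance instSetoid : Setoid CellComplex where
  r := Isomorphic
  iseqv :=
    { refl := fun _ => ⟨Equiv.refl _, Equiv.refl _, by simp, by simp⟩
      symm := by
        rintro X Y ⟨f, e, h, hd⟩
        refine ⟨f.symm, e.symm, fun c v => ?_, fun c => ?_⟩
        · rw [← h]
          simp
        · rw [← hd]
          simp
      trans := by
        rintro X Y Z ⟨f, e, h, hd⟩ ⟨f', e', h', hd'⟩
        exact ⟨f.trans f', e.trans e', by simp [h, h'], by simp [hd, hd']⟩ }

open Classical in
/-- The cells of a finite abstract simplicial complex `K` are its faces, and its vertices are the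
points lying in some face. -/
noncomputable def ofSimplicial {V : Type} (K : PreAbstractSimplicialComplex V)
    (hK : K.faces.Finite) : CellComplex where
  Vert := {v : V // ∃ s ∈ K.faces, v ∈ s}
  Cell := K.faces
  fintypeCell := hK.fintype
  support s := s.1.subtype (fun v => ∃ s ∈ K.faces, v ∈ s)
  dim s := s.1.card - 1
  support_nonempty s := by
    obtain ⟨v, hv⟩ := (K.isRelLowerSet_faces s.2).1
    exact ⟨⟨v, s.1, s.2, hv⟩, by simpa using hv⟩
  support_injective s t h := by
    change s.1.subtype _ = t.1.subtype _ at h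
    apply Subtype.ext
    ext v
    constructor
    · intro hv
      have : (⟨v, s.1, s.2, hv⟩ : {v : V // ∃ s ∈ K.faces, v ∈ s}) ∈
          s.1.subtype (fun v => ∃ s ∈ K.faces, v ∈ s) := by simpa using hv
      rw [h] at this
      simpa using this
    · intro hv
      have : (⟨v, t.1, t.2, hv⟩ : {v : V // ∃ s ∈ K.faces, v ∈ s}) ∈
          t.1.subtype (fun v => ∃ s ∈ K.faces, v ∈ s) := by simpa using hv
      rw [← h] at this
      simpa using this
  exists_mem_support := by
    rintro ⟨v, s, hs, hv⟩
    exact ⟨⟨s, hs⟩, by simpa using hv⟩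

/-- The empty complex. -/
abbrev empty : CellComplex where
  Vert := Empty
  Cell := Empty
  fintypeCell := inferInstance
  support := fun c => c.elim
  dim := fun c => c.elim
  support_nonempty := fun c => c.elim
  support_injective := fun c => c.elim
  exists_mem_support := fun c => c.elim

/-- The one-point complex. -/
abbrev point : CellComplex where
  Vert := Unit
  Cell := Unit
  fintypeCell := inferInstance
  support := fun _ => {()}
  dim := fun _ => 0
  support_nonempty := by simp
  support_injective := fun _ _ _ => rfl
  exists_mem_support := by simp

/-- The disjoint union. -/
abbrev sum (X Y : CellComplex) : CellComplex where
  Vert := X.Vert ⊕ Y.Vert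
  Cell := X.Cell ⊕ Y.Cell
  fintypeCell := inferInstance
  support := Sum.elim (fun c => (X.support c).map Function.Embedding.inl)
    (fun d => (Y.support d).map Function.Embedding.inr)
  dim := Sum.elim X.dim Y.dim
  support_nonempty := by
    rintro (c | c)
    · simpa using X.support_nonempty c
    · simpa using Y.support_nonempty c
  support_injective := by
    rintro (c | c) (d | d) h
    · exact congrArg Sum.inl (X.support_injective (Finset.map_injective _ h))
    · obtain ⟨v, hv⟩ := X.support_nonempty c
      have h1 : Sum.inl v ∈ (X.support c).map
          (Function.Embedding.inl : X.Vert ↪ X.Vert ⊕ Y.Vert) := by simpa using hv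
      simp only [Sum.elim_inl, Sum.elim_inr] at h
      rw [h] at h1
      simp at h1
    · obtain ⟨v, hv⟩ := Y.support_nonempty c
      have h1 : Sum.inr v ∈ (Y.support c).map
          (Function.Embedding.inr : Y.Vert ↪ X.Vert ⊕ Y.Vert) := by simpa using hv
      simp only [Sum.elim_inl, Sum.elim_inr] at h
      rw [h] at h1
      simp at h1
    · exact congrArg Sum.inr (Y.support_injective (Finset.map_injective _ h))
  exists_mem_support := by
    rintro (v | v)
    · obtain ⟨c, hc⟩ := X.exists_mem_support v
      exact ⟨Sum.inl c, by simpa using hc⟩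
    · obtain ⟨c, hc⟩ := Y.exists_mem_support v
      exact ⟨Sum.inr c, by simpa using hc⟩

/-- The Cartesian product: its cells are the set products `x × y` of cells of the factors. -/
abbrev prod (X Y : CellComplex) : CellComplex where
  Vert := X.Vert × Y.Vert
  Cell := X.Cell × Y.Cell
  fintypeCell := inferInstance
  support := fun c => X.support c.1 ×ˢ Y.support c.2
  dim := fun c => X.dim c.1 + Y.dim c.2
  support_nonempty := fun c => (X.support_nonempty c.1).product (Y.support_nonempty c.2)
  support_injective := by
    rintro ⟨c, d⟩ ⟨c', d'⟩ h
    obtain ⟨v, hv⟩ := X.support_nonempty c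
    obtain ⟨w, hw⟩ := Y.support_nonempty d
    have key : ∀ v w, (v ∈ X.support c ∧ w ∈ Y.support d) ↔
        (v ∈ X.support c' ∧ w ∈ Y.support d') := fun v w => by
      rw [← Finset.mem_product (p := (v, w)), ← Finset.mem_product (p := (v, w))]
      exact Finset.ext_iff.1 h (v, w)
    obtain ⟨hv', hw'⟩ := (key v w).1 ⟨hv, hw⟩
    refine Prod.ext (X.support_injective ?_) (Y.support_injective ?_)
    · ext u
      exact ⟨fun hu => ((key u w).1 ⟨hu, hw⟩).1, fun hu => ((key u w).2 ⟨hu, hw'⟩).1⟩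
    · ext u
      exact ⟨fun hu => ((key v u).1 ⟨hv, hu⟩).2, fun hu => ((key v u).2 ⟨hv', hu⟩).2⟩
  exists_mem_support := by
    rintro ⟨v, w⟩
    obtain ⟨c, hc⟩ := X.exists_mem_support v
    obtain ⟨d, hd⟩ := Y.exists_mem_support w
    exact ⟨(c, d), by simp [hc, hd]⟩

theorem sum_congr {X X' Y Y' : CellComplex} (h : X ≈ X') (h' : Y ≈ Y') :
    X.sum Y ≈ X'.sum Y' := by
  obtain ⟨f, e, h, hd⟩ := h
  obtain ⟨f', e', h', hd'⟩ := h'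
  refine ⟨f.sumCongr f', e.sumCongr e', ?_, ?_⟩
  · rintro (c | c) (v | v) <;> simp [sum, h, h']
  · rintro (c | c) <;> simp [sum, hd, hd']

theorem prod_congr {X X' Y Y' : CellComplex} (h : X ≈ X') (h' : Y ≈ Y') :
    X.prod Y ≈ X'.prod Y' := by
  obtain ⟨f, e, h, hd⟩ := h
  obtain ⟨f', e', h', hd'⟩ := h'
  refine ⟨f.prodCongr f', e.prodCongr e', ?_, ?_⟩
  · rintro ⟨c, d⟩ ⟨v, w⟩
    simp [prod, h, h']
  · rintro ⟨c, d⟩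
    simp [prod, hd, hd']

/-- The connection graph: the vertices are the cells, and two different cells are adjacent if they
intersect. -/
def connectionGraph (X : CellComplex) : SimpleGraph X.Cell where
  Adj c d := c ≠ d ∧ ∃ v, v ∈ X.support c ∧ v ∈ X.support d
  symm := ⟨fun _ _ h => ⟨h.1.symm, h.2.imp fun _ hv => hv.symm⟩⟩
  loopless := ⟨fun _ h => h.1 rfl⟩

open Classical in
/-- The connection Laplacian `1 + A`, with `A` the adjacency matrix of the connection graph. -/
noncomputable def connectionLaplacian (X : CellComplex) : Matrix X.Cell X.Cell ℤ :=
  1 + X.connectionGraph.adjMatrix ℤ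

/-- The Euler characteristic, the sum over all cells `x` of `ω(x) = (-1) ^ dim x`. -/
def eulerChar (X : CellComplex) : ℤ := ∑ c, (-1) ^ X.dim c

theorem eulerChar_congr {X Y : CellComplex} (h : X ≈ Y) : X.eulerChar = Y.eulerChar := by
  obtain ⟨f, e, -, hd⟩ := h
  exact Fintype.sum_equiv e _ _ fun c => by rw [hd]

end CellComplex

/-- Isomorphism classes of finite cell complexes. -/
def CellClass : Type 1 := Quotient CellComplex.instSetoid

namespace CellClass

/-- The isomorphism class of a complex. -/
def mk (X : CellComplex) : CellClass := Quotient.mk _ X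

instance instZero : Zero CellClass := ⟨mk CellComplex.empty⟩

instance instOne : One CellClass := ⟨mk CellComplex.point⟩

/-- Addition is the disjoint union. -/
instance instAdd : Add CellClass :=
  ⟨Quotient.map₂ CellComplex.sum fun _ _ h _ _ h' => CellComplex.sum_congr h h'⟩

/-- Multiplication is the Cartesian product. -/
instance instMul : Mul CellClass :=
  ⟨Quotient.map₂ CellComplex.prod fun _ _ h _ _ h' => CellComplex.prod_congr h h'⟩

theorem zero_add' (a : CellClass) : 0 + a = a := by
  induction a using Quotient.inductionOn with | h X =>
  refine Quotient.sound ⟨Equiv.emptySum Empty X.Vert, Equiv.emptySum Empty X.Cell, ?_, ?_⟩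
  · rintro (c | c) (v | v)
    · exact c.elim
    · exact c.elim
    · exact v.elim
    · simp [CellComplex.sum]
  · rintro (c | c)
    · exact c.elim
    · rfl

theorem add_comm' (a b : CellClass) : a + b = b + a := by
  induction a using Quotient.inductionOn with | h X =>
  induction b using Quotient.inductionOn with | h Y =>
  refine Quotient.sound ⟨Equiv.sumComm _ _, Equiv.sumComm _ _, ?_, ?_⟩
  · rintro (c | c) (v | v) <;> simp [CellComplex.sum]
  · rintro (c | c) <;> rfl

theorem add_assoc' (a b c : CellClass) : a + b + c = a + (b + c) := by
  induction a using Quotient.inductionOn with | h X =>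
  induction b using Quotient.inductionOn with | h Y =>
  induction c using Quotient.inductionOn with | h Z =>
  refine Quotient.sound ⟨Equiv.sumAssoc _ _ _, Equiv.sumAssoc _ _ _, ?_, ?_⟩
  · rintro ((c | c) | c) ((v | v) | v) <;> simp [CellComplex.sum]
  · rintro ((c | c) | c) <;> rfl

theorem mul_comm' (a b : CellClass) : a * b = b * a := by
  induction a using Quotient.inductionOn with | h X =>
  induction b using Quotient.inductionOn with | h Y =>
  refine Quotient.sound ⟨Equiv.prodComm _ _, Equiv.prodComm _ _, ?_, ?_⟩
  · rintro ⟨c, d⟩ ⟨v, w⟩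
    simp [CellComplex.prod, and_comm]
  · rintro ⟨c, d⟩
    simp [CellComplex.prod, add_comm]

theorem mul_assoc' (a b c : CellClass) : a * b * c = a * (b * c) := by
  induction a using Quotient.inductionOn with | h X =>
  induction b using Quotient.inductionOn with | h Y =>
  induction c using Quotient.inductionOn with | h Z =>
  refine Quotient.sound ⟨Equiv.prodAssoc _ _ _, Equiv.prodAssoc _ _ _, ?_, ?_⟩
  · rintro ⟨⟨c, d⟩, e⟩ ⟨⟨u, v⟩, w⟩
    simp [CellComplex.prod, and_assoc]
  · rintro ⟨⟨c, d⟩, e⟩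
    simp [CellComplex.prod, add_assoc]

theorem one_mul' (a : CellClass) : 1 * a = a := by
  induction a using Quotient.inductionOn with | h X =>
  refine Quotient.sound ⟨Equiv.punitProd _, Equiv.punitProd _, ?_, ?_⟩
  · rintro ⟨c, d⟩ ⟨v, w⟩
    simp [CellComplex.prod, CellComplex.point]
  · rintro ⟨c, d⟩
    simp [CellComplex.prod, CellComplex.point]

theorem zero_mul' (a : CellClass) : 0 * a = 0 := by
  induction a using Quotient.inductionOn with | h X =>
  refine Quotient.sound ⟨Equiv.emptyProd _, Equiv.emptyProd _, ?_, ?_⟩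
  · rintro ⟨c, d⟩
    exact c.elim
  · rintro ⟨c, d⟩
    exact c.elim

theorem add_mul' (a b c : CellClass) : (a + b) * c = a * c + b * c := by
  induction a using Quotient.inductionOn with | h X =>
  induction b using Quotient.inductionOn with | h Y =>
  induction c using Quotient.inductionOn with | h Z =>
  refine Quotient.sound ⟨Equiv.sumProdDistrib _ _ _, Equiv.sumProdDistrib _ _ _, ?_, ?_⟩
  · rintro ⟨c | c, d⟩ ⟨v | v, w⟩ <;> simp [CellComplex.prod, CellComplex.sum]
  · rintro ⟨c | c, d⟩ <;> simp [CellComplex.prod, CellComplex.sum]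

instance instCommSemiring : CommSemiring CellClass where
  add_assoc := add_assoc'
  zero_add := zero_add'
  add_zero a := by rw [add_comm', zero_add']
  add_comm := add_comm'
  mul_assoc := mul_assoc'
  one_mul := one_mul'
  mul_one a := by rw [mul_comm', one_mul']
  mul_comm := mul_comm'
  zero_mul := zero_mul'
  mul_zero a := by rw [mul_comm', zero_mul']
  left_distrib a b c := by rw [mul_comm', add_mul', mul_comm' b, mul_comm' c]
  right_distrib := add_mul'
  nsmul := nsmulRec

/-- The Euler characteristic as a semiring homomorphism. -/
def eulerChar : CellClass →+* ℤ where
  toFun := Quotient.lift CellComplex.eulerChar fun _ _ h => CellComplex.eulerChar_congr h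
  map_zero' := rfl
  map_one' := rfl
  map_add' a b := by
    induction a using Quotient.inductionOn with | h X =>
    induction b using Quotient.inductionOn with | h Y =>
    exact Fintype.sum_sum_type _
  map_mul' a b := by
    induction a using Quotient.inductionOn with | h X =>
    induction b using Quotient.inductionOn with | h Y =>
    change ∑ c : X.Cell × Y.Cell, (-1 : ℤ) ^ (X.dim c.1 + Y.dim c.2) =
      (∑ c, (-1) ^ X.dim c) * ∑ d, (-1) ^ Y.dim d
    rw [Finset.sum_mul_sum, Fintype.sum_prod_type]
    simp only [pow_add]

/-- The classes of finite abstract simplicial complexes. -/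
def simplicial : Set CellClass :=
  {a | ∃ (V : Type) (K : PreAbstractSimplicialComplex V) (hK : K.faces.Finite),
    a = mk (CellComplex.ofSimplicial K hK)}

end CellClass

/-! ### The strong ring -/

/-- The Grothendieck ring of isomorphism classes of finite cell complexes, with disjoint union as
addition and the Cartesian product as multiplication. -/
abbrev CellRing : Type 1 := Algebra.GrothendieckAddGroup CellClass

namespace CellRing

/-- The ring element represented by a cell complex. -/
noncomputable def ofComplex (X : CellComplex) : CellRing :=
  Algebra.GrothendieckAddGroup.of (CellClass.mk X)

/-- The Euler characteristic as a ring homomorphism. -/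
noncomputable def eulerChar : CellRing →+* ℤ :=
  Algebra.GrothendieckAddGroup.liftRingHom CellClass.eulerChar

theorem eulerChar_ofComplex (X : CellComplex) : eulerChar (ofComplex X) = X.eulerChar :=
  Algebra.GrothendieckAddGroup.lift_of CellClass.eulerChar.toAddMonoidHom (CellClass.mk X)

end CellRing

/-- The strong ring: the subring generated by the finite abstract simplicial complexes. -/
noncomputable def strongRing : Subring CellRing :=
  Subring.closure (Algebra.GrothendieckAddGroup.of '' CellClass.simplicial)

/-- A cell complex obtained from finite abstract simplicial complexes by forming disjoint unions
and Cartesian products, up to isomorphism. -/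
def CellComplex.IsStrong (X : CellComplex) : Prop :=
  CellClass.mk X ∈ Subsemiring.closure CellClass.simplicial

/-- A signed complex `P ⊕ (-N)`, where `P` and `N` are disjoint unions of products of finite
abstract simplicial complexes. -/
structure SignedComplex : Type 1 where
  pos : CellComplex
  neg : CellComplex
  isStrong_pos : pos.IsStrong
  isStrong_neg : neg.IsStrong

namespace SignedComplex

/-- The ring element represented by a signed complex. -/
noncomputable def toRing (G : SignedComplex) : CellRing :=
  CellRing.ofComplex G.pos - CellRing.ofComplex G.neg

/-- The cells of a signed complex. -/
abbrev Cell (G : SignedComplex) : Type := G.pos.Cell ⊕ G.neg.Cell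

/-- The connection Laplacian `L(P ⊕ (-N)) = L(P) ⊕ (-L(N))`. -/
noncomputable def connectionLaplacian (G : SignedComplex) : Matrix G.Cell G.Cell ℤ :=
  Matrix.fromBlocks G.pos.connectionLaplacian 0 0 (-G.neg.connectionLaplacian)

/-- The negative complex `-(P ⊕ (-N)) = N ⊕ (-P)`. -/
def negate (G : SignedComplex) : SignedComplex where
  pos := G.neg
  neg := G.pos
  isStrong_pos := G.isStrong_neg
  isStrong_neg := G.isStrong_pos

end SignedComplex

/-! ### Alternating sums over finite sets -/

namespace Finset

variable {α : Type*}

/-! Everything rests on an explicit integral inverse of the connection Laplacian. For a simplicial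
complex write ω for the sign of a face; the entry L(s,t) is 1 exactly when s and t meet. The inverse
is g(s,t) = ω(s)ω(t) ∑ ω(w), summed over the faces w containing both s and t. In L·g, exchange the
sums. For fixed w, the sum of ω(u) over faces u ⊆ w meeting s is 1 if w ⊆ s and 0 otherwise
(`sum_sign_subset_of_not_disjoint`). What remains is the sum of ω(w) over t ⊆ w ⊆ s, which vanishes
unless s = t (`sum_sign_Icc`). The energy ∑ g(s,t) becomes ∑ ω(w)χ(w)², where χ(w) = 1 is the Euler
characteristic of a full simplex (`sum_green`). The property `HasEnergy` passes to disjoint unions,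
where L is block diagonal, and to products, where L is a Kronecker product, hence to every strong
complex. A sign change on the negative block gives signed complexes, and these exhaust the strong
ring because the differences of strong classes already form a ring. -/

theorem Nonempty.neg_one_pow_card_sub_one {s : Finset α} (hs : s.Nonempty) :
    (-1 : ℤ) ^ (s.card - 1) = -(-1) ^ s.card := by
  obtain ⟨n, hn⟩ := Nat.exists_eq_add_of_lt hs.card_pos
  rw [hn]
  simp [pow_succ]

variable [DecidableEq α]

/-- The sets between s and t are s ∪ u with u ⊆ t \ s, and the alternating sum over u cancels unless
t \ s is empty. -/
theorem sum_powerset_ite_subset_neg_one_pow_card (s t : Finset α) :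
    ∑ w ∈ t.powerset, (if s ⊆ w then (-1 : ℤ) ^ w.card else 0) =
      if t = s then (-1 : ℤ) ^ s.card else 0 := by
  by_cases hst : s ⊆ t
  · have hfilter : t.powerset.filter (fun w => s ⊆ w) = (t \ s).powerset.image (s ∪ ·) := by
      rw [← Icc_eq_image_powerset hst]
      ext w
      simp [and_comm]
    have hdisj : ∀ u ∈ (t \ s).powerset, Disjoint s u := fun u hu =>
      disjoint_sdiff.mono_right (mem_powerset.1 hu)
    have hinj : Set.InjOn (s ∪ ·) ((t \ s).powerset : Set (Finset α)) := fun u hu v hv h => by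
      have hu' := hdisj u hu
      have hv' := hdisj v hv
      rw [← union_sdiff_cancel_left hu', ← union_sdiff_cancel_left hv']
      exact congrArg (· \ s) h
    rw [← sum_filter, hfilter, sum_image hinj,
      sum_congr rfl fun u hu => by rw [card_union_of_disjoint (hdisj u hu), pow_add], ← mul_sum,
      sum_powerset_neg_one_pow_card]
    have : t \ s = ∅ ↔ t = s := by
      rw [sdiff_eq_empty_iff_subset]
      exact ⟨fun h => h.antisymm hst, fun h => h.le⟩
    simp [this]
  · rw [if_neg (fun h => hst h.ge), sum_eq_zero]
    intro w hw
    rw [if_neg fun h => hst (h.trans (mem_powerset.1 hw))]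

/-- The subsets of t avoiding s are the subsets of t \ s, whose alternating sum is 0 unless t \ s is
empty. -/
theorem sum_powerset_ite_disjoint_neg_one_pow_card (s t : Finset α) :
    ∑ w ∈ t.powerset, (if Disjoint s w then (-1 : ℤ) ^ w.card else 0) =
      if t ⊆ s then 1 else 0 := by
  have hfilter : t.powerset.filter (fun w => Disjoint s w) = (t \ s).powerset := by
    ext w
    simp [subset_sdiff, disjoint_comm]
  rw [← sum_filter, hfilter, sum_powerset_neg_one_pow_card]
  simp [sdiff_eq_empty_iff_subset]

end Finset

/-! ### Sums over the faces of a simplicial complex -/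

namespace PreAbstractSimplicialComplex

variable {V : Type*} (K : PreAbstractSimplicialComplex V)

theorem nonempty_face (s : K.faces) : s.1.Nonempty :=
  (K.isRelLowerSet_faces s.2).1

/-- The sign `(-1) ^ dim s` of a face `s`. -/
def sign (s : K.faces) : ℤ := (-1) ^ (s.1.card - 1)

theorem sign_mul_self (s : K.faces) : K.sign s * K.sign s = 1 := by
  rw [sign, ← mul_pow]
  simp

theorem sign_eq (s : K.faces) : K.sign s = -(-1) ^ s.1.card :=
  (K.nonempty_face s).neg_one_pow_card_sub_one

variable [DecidableEq V] [Fintype K.faces]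

/-- Every nonempty subset of a face is a face, so only the empty set has to be removed from the
powerset. This reduces sums over faces to the alternating sums above. -/
theorem sum_faces_subset (f : Finset V → ℤ) (t : K.faces) :
    ∑ s : K.faces, (if s.1 ⊆ t.1 then f s.1 else 0) = ∑ s ∈ t.1.powerset, f s - f ∅ := by
  rw [← Finset.sum_erase_eq_sub (Finset.empty_mem_powerset _), ← Finset.sum_filter]
  refine Finset.sum_bij (fun s _ => s.1) (fun s hs => ?_) (fun s _ s' _ h => Subtype.ext h)
    (fun s hs => ?_) fun _ _ => rfl
  · exact Finset.mem_erase.2 ⟨(K.nonempty_face s).ne_empty,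
      Finset.mem_powerset.2 (Finset.mem_filter.1 hs).2⟩
  · obtain ⟨hne, hst⟩ := Finset.mem_erase.1 hs
    rw [Finset.mem_powerset] at hst
    exact ⟨⟨s, (K.isRelLowerSet_faces t.2).2 hst (Finset.nonempty_iff_ne_empty.2 hne)⟩,
      Finset.mem_filter.2 ⟨Finset.mem_univ _, hst⟩, rfl⟩

theorem sum_sign_subset (t : K.faces) :
    ∑ s : K.faces, (if s.1 ⊆ t.1 then K.sign s else 0) = 1 := by
  simp only [sign_eq]
  rw [K.sum_faces_subset (fun s => -(-1) ^ s.card) t, Finset.sum_neg_distrib,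
    Finset.sum_powerset_neg_one_pow_card_of_nonempty (K.nonempty_face t)]
  simp

/-- Subtract from the Euler characteristic 1 of the full simplex t the contribution of the nonempty
subsets of t \ s, which is 1 if t \ s is nonempty and 0 otherwise. -/
theorem sum_sign_subset_of_not_disjoint (s t : K.faces) :
    ∑ u : K.faces, (if u.1 ⊆ t.1 then (if Disjoint s.1 u.1 then 0 else K.sign u) else 0) =
      if t.1 ⊆ s.1 then 1 else 0 := by
  have h := K.sum_faces_subset (fun u => if Disjoint s.1 u then -(-1 : ℤ) ^ u.card else 0) t
  have h' := Finset.sum_powerset_ite_disjoint_neg_one_pow_card s.1 t.1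
  have hneg : ∑ u ∈ t.1.powerset, (if Disjoint s.1 u then -(-1 : ℤ) ^ u.card else 0) =
      -∑ u ∈ t.1.powerset, (if Disjoint s.1 u then (-1 : ℤ) ^ u.card else 0) := by
    rw [← Finset.sum_neg_distrib]
    exact Finset.sum_congr rfl fun u _ => by split_ifs <;> simp
  rw [hneg, h'] at h
  have hsub : ∑ u : K.faces,
      (if u.1 ⊆ t.1 then (if Disjoint s.1 u.1 then 0 else K.sign u) else 0) =
      ∑ u : K.faces, (if u.1 ⊆ t.1 then K.sign u else 0) - ∑ u : K.faces,
        (if u.1 ⊆ t.1 then (if Disjoint s.1 u.1 then -(-1 : ℤ) ^ u.1.card else 0) else 0) := by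
    rw [← Finset.sum_sub_distrib]
    refine Finset.sum_congr rfl fun u _ => ?_
    rw [sign_eq]
    split_ifs <;> simp
  rw [hsub, h, K.sum_sign_subset]
  -- The empty set is disjoint from s and contributes -1 to the powerset sum, so the claim reads 1 -
  -- (1 - [t ⊆ s]) = [t ⊆ s].
  simp

theorem sum_sign_Icc (s t : K.faces) :
    ∑ u : K.faces, (if u.1 ⊆ t.1 then (if s.1 ⊆ u.1 then K.sign u else 0) else 0) =
      if t = s then K.sign s else 0 := by
  simp only [sign_eq]
  rw [K.sum_faces_subset (fun u => if s.1 ⊆ u then -(-1 : ℤ) ^ u.card else 0) t]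
  have h := Finset.sum_powerset_ite_subset_neg_one_pow_card s.1 t.1
  have hneg : ∑ u ∈ t.1.powerset, (if s.1 ⊆ u then -(-1 : ℤ) ^ u.card else 0) =
      -∑ u ∈ t.1.powerset, (if s.1 ⊆ u then (-1 : ℤ) ^ u.card else 0) := by
    rw [← Finset.sum_neg_distrib]
    exact Finset.sum_congr rfl fun u _ => by split_ifs <;> simp
  rw [hneg, h]
  -- The correction term at the empty set vanishes because a nonempty s is not contained in it.
  have hs := (K.nonempty_face s).ne_empty
  simp only [Finset.subset_empty, hs, if_false, sub_zero, Subtype.ext_iff]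
  split_ifs <;> simp

/-- The Green function of a simplicial complex: the entry at `(s, t)` is, up to the signs of `s` and
`t`, the Euler characteristic of the intersection of the stars of `s` and `t`. -/
def green : Matrix K.faces K.faces ℤ := fun s t =>
  K.sign s * K.sign t * ∑ u : K.faces, if s.1 ⊆ u.1 then (if t.1 ⊆ u.1 then K.sign u else 0) else 0

theorem sum_not_disjoint_mul_green (s t : K.faces) :
    ∑ u : K.faces, (if Disjoint s.1 u.1 then 0 else 1) * K.green u t =
      if s = t then 1 else 0 := by
  calc
    _ = ∑ u : K.faces, ∑ w : K.faces, K.sign t * (if t.1 ⊆ w.1 then K.sign w else 0) *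
          (if u.1 ⊆ w.1 then (if Disjoint s.1 u.1 then 0 else K.sign u) else 0) := by
      refine Finset.sum_congr rfl fun u _ => ?_
      rw [green, Finset.mul_sum, Finset.mul_sum]
      refine Finset.sum_congr rfl fun w _ => ?_
      split_ifs <;> ring
    _ = ∑ w : K.faces, K.sign t *
          (if w.1 ⊆ s.1 then (if t.1 ⊆ w.1 then K.sign w else 0) else 0) := by
      rw [Finset.sum_comm]
      refine Finset.sum_congr rfl fun w _ => ?_
      rw [← Finset.mul_sum, sum_sign_subset_of_not_disjoint]
      split_ifs <;> ring
    _ = _ := by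
      rw [← Finset.mul_sum, sum_sign_Icc, mul_ite, sign_mul_self, mul_zero]

/-- With u summed last, the sums over s ⊆ u and t ⊆ u separate, and each equals 1 by
`sum_sign_subset`. -/
theorem sum_green : ∑ s, ∑ t, K.green s t = ∑ u, K.sign u := by
  calc
    _ = ∑ s : K.faces, ∑ t : K.faces, ∑ u : K.faces, K.sign u *
          (if s.1 ⊆ u.1 then K.sign s else 0) * (if t.1 ⊆ u.1 then K.sign t else 0) := by
      refine Finset.sum_congr rfl fun s _ => Finset.sum_congr rfl fun t _ => ?_
      rw [green, Finset.mul_sum]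
      refine Finset.sum_congr rfl fun u _ => ?_
      split_ifs <;> ring
    _ = ∑ u : K.faces, ∑ s : K.faces, ∑ t : K.faces, K.sign u *
          (if s.1 ⊆ u.1 then K.sign s else 0) * (if t.1 ⊆ u.1 then K.sign t else 0) := by
      rw [Finset.sum_comm_cycle]
    _ = _ := by
      refine Finset.sum_congr rfl fun u _ => ?_
      simp only [← Finset.mul_sum, sum_sign_subset, mul_one]

end PreAbstractSimplicialComplex

/-! ### The energy theorem for cell complexes -/

namespace CellComplex

open Classical in
-- The diagonal fits the intersection rule because supports are nonempty, so identity and adjacency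
-- matrix merge into one indicator.
theorem connectionLaplacian_apply (X : CellComplex) (c d : X.Cell) :
    X.connectionLaplacian c d = if Disjoint (X.support c) (X.support d) then 0 else 1 := by
  by_cases hcd : c = d
  · subst hcd
    have := (X.support_nonempty c).ne_empty
    simp only [connectionLaplacian, Matrix.add_apply, Matrix.one_apply_eq,
      SimpleGraph.adjMatrix_apply, SimpleGraph.irrefl, if_false, add_zero, disjoint_self,
      Finset.bot_eq_empty, this]
  · simp only [connectionLaplacian, connectionGraph, Matrix.add_apply, Matrix.one_apply, hcd,
      SimpleGraph.adjMatrix_apply, if_false, zero_add, ne_eq,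
      not_false_eq_true, true_and, ← Finset.not_disjoint_iff]
    split_ifs <;> simp_all

open Classical in
/-- The connection Laplacian has an integral inverse, the entries of which add up to the Euler
characteristic. -/
def HasEnergy (X : CellComplex) : Prop :=
  ∃ g : Matrix X.Cell X.Cell ℤ,
    (∀ c d, ∑ b, X.connectionLaplacian c b * g b d = if c = d then 1 else 0) ∧
      ∑ c, ∑ d, g c d = X.eulerChar

theorem HasEnergy.of_equiv {X Y : CellComplex} (h : X ≈ Y) (hX : X.HasEnergy) : Y.HasEnergy := by
  classical
  have hχ := eulerChar_congr h
  obtain ⟨f, e, hs, -⟩ := h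
  obtain ⟨g, hg, hsum⟩ := hX
  have hL : ∀ c d, Y.connectionLaplacian (e c) (e d) = X.connectionLaplacian c d := fun c d => by
    have : Disjoint (Y.support (e c)) (Y.support (e d)) ↔
        Disjoint (X.support c) (X.support d) := by
      simp only [Finset.disjoint_left, ← f.forall_congr_right (q := fun v => v ∈ Y.support (e c) → _),
        hs]
    simp only [connectionLaplacian_apply, this]
  refine ⟨fun c d => g (e.symm c) (e.symm d), fun c d => ?_, ?_⟩
  · obtain ⟨c, rfl⟩ := e.surjective c
    obtain ⟨d, rfl⟩ := e.surjective d
    rw [← e.sum_comp]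
    simpa [hL] using hg c d
  · rw [← hχ, ← hsum, ← e.sum_comp]
    refine Finset.sum_congr rfl fun c _ => ?_
    rw [← e.sum_comp]
    simp

theorem hasEnergy_empty : empty.HasEnergy :=
  ⟨0, fun c => c.elim, rfl⟩

theorem hasEnergy_point : point.HasEnergy :=
  ⟨1, fun c d => by simp [connectionLaplacian_apply], by simp [eulerChar]⟩

theorem HasEnergy.sum {X Y : CellComplex} (hX : X.HasEnergy) (hY : Y.HasEnergy) :
    (X.sum Y).HasEnergy := by
  classical
  obtain ⟨g, hg, hgs⟩ := hX
  obtain ⟨g', hg', hgs'⟩ := hY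
  refine ⟨Matrix.fromBlocks g 0 0 g', ?_, ?_⟩
  · have hl : ∀ c d, (X.sum Y).connectionLaplacian (.inl c) (.inl d) =
        X.connectionLaplacian c d := fun c d => by
      simp only [connectionLaplacian_apply, Sum.elim_inl, Finset.disjoint_map]
    have hr : ∀ c d, (X.sum Y).connectionLaplacian (.inr c) (.inr d) =
        Y.connectionLaplacian c d := fun c d => by
      simp only [connectionLaplacian_apply, Sum.elim_inr, Finset.disjoint_map]
    have hlr : ∀ c d, (X.sum Y).connectionLaplacian (.inl c) (.inr d) = 0 := fun c d => by
      simp [connectionLaplacian_apply, Finset.disjoint_left]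
    have hrl : ∀ c d, (X.sum Y).connectionLaplacian (.inr c) (.inl d) = 0 := fun c d => by
      simp [connectionLaplacian_apply, Finset.disjoint_left]
    rintro (c | c) (d | d) <;> rw [Fintype.sum_sum_type] <;> simp [hl, hr, hlr, hrl, hg, hg']
  · rw [Fintype.sum_sum_type]
    simp only [Fintype.sum_sum_type, Matrix.fromBlocks_apply₁₁, Matrix.fromBlocks_apply₁₂,
      Matrix.fromBlocks_apply₂₁, Matrix.fromBlocks_apply₂₂, Matrix.zero_apply,
      Finset.sum_const_zero, add_zero, zero_add, hgs, hgs']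
    exact (CellClass.eulerChar.map_add (CellClass.mk X) (CellClass.mk Y)).symm

/-- Two product sets meet exactly when both pairs of factors meet. Hence L is the Kronecker product
of the two Laplacians, its inverse is the Kronecker product of the inverses, and the total energies
multiply. -/
theorem HasEnergy.prod {X Y : CellComplex} (hX : X.HasEnergy) (hY : Y.HasEnergy) :
    (X.prod Y).HasEnergy := by
  classical
  obtain ⟨g, hg, hgs⟩ := hX
  obtain ⟨g', hg', hgs'⟩ := hY
  refine ⟨fun c d => g c.1 d.1 * g' c.2 d.2, ?_, ?_⟩
  · have hL : ∀ c d, (X.prod Y).connectionLaplacian c d =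
        X.connectionLaplacian c.1 d.1 * Y.connectionLaplacian c.2 d.2 := fun c d => by
      simp only [connectionLaplacian_apply, Finset.disjoint_product]
      split_ifs <;> simp_all
    rintro ⟨c, c'⟩ ⟨d, d'⟩
    simp only [hL, Fintype.sum_prod_type]
    calc
      _ = (∑ b, X.connectionLaplacian c b * g b d) *
          ∑ b, Y.connectionLaplacian c' b * g' b d' := by
        rw [Finset.sum_mul_sum]
        refine Finset.sum_congr rfl fun b _ => Finset.sum_congr rfl fun b' _ => ?_
        ring
      _ = _ := by
        rw [hg, hg']
        simp only [Prod.mk.injEq, ite_and, ite_mul, one_mul, zero_mul]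
  · have hχ : (X.prod Y).eulerChar = X.eulerChar * Y.eulerChar :=
      CellClass.eulerChar.map_mul (CellClass.mk X) (CellClass.mk Y)
    rw [hχ, ← hgs, ← hgs']
    simp only [Fintype.sum_prod_type, Finset.sum_mul_sum]

theorem hasEnergy_ofSimplicial {V : Type} (K : PreAbstractSimplicialComplex V)
    (hK : K.faces.Finite) : (ofSimplicial K hK).HasEnergy := by
  classical
  -- This is the instance stored in `ofSimplicial`, so the sums of `K.sum_green` agree
  -- definitionally with those required.
  let _ : Fintype K.faces := hK.fintype
  have hL : ∀ s t : K.faces, (ofSimplicial K hK).connectionLaplacian s t =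
      if Disjoint s.1 t.1 then 0 else 1 := fun s t => by
    refine (connectionLaplacian_apply (ofSimplicial K hK) s t).trans ?_
    have : Disjoint ((ofSimplicial K hK).support s) ((ofSimplicial K hK).support t) ↔
        Disjoint s.1 t.1 :=
      ⟨fun h => Finset.disjoint_left.2 fun v hv hv' =>
        have hmem : ∀ w : K.faces, v ∈ w.1 → (⟨v, s.1, s.2, hv⟩ : (ofSimplicial K hK).Vert) ∈
            (ofSimplicial K hK).support w := fun _ hw => Finset.mem_subtype.2 hw
        Finset.disjoint_left.1 h (hmem s hv) (hmem t hv'),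
        fun h => Finset.disjoint_left.2 fun v hv hv' =>
          Finset.disjoint_left.1 h (Finset.mem_subtype.1 hv) (Finset.mem_subtype.1 hv')⟩
    simp only [this]
  refine ⟨K.green, fun s t => ?_, K.sum_green⟩
  refine (Finset.sum_congr rfl fun u _ => by rw [hL s u]).trans
    ((K.sum_not_disjoint_mul_green s t).trans ?_)
  congr

theorem IsStrong.hasEnergy {X : CellComplex} (hX : X.IsStrong) : X.HasEnergy := by
  -- Quantifying over all representatives of a class lets the closure induction choose convenient
  -- ones and transport the result by `HasEnergy.of_equiv`.
  suffices h : ∀ a ∈ Subsemiring.closure CellClass.simplicial,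
      ∀ Y, CellClass.mk Y = a → Y.HasEnergy from h _ hX X rfl
  intro a ha
  induction ha using Subsemiring.closure_induction with
  | mem a ha =>
    obtain ⟨V, K, hK, rfl⟩ := ha
    exact fun Y hY => (hasEnergy_ofSimplicial K hK).of_equiv (Quotient.exact hY.symm)
  | zero => exact fun Y hY => hasEnergy_empty.of_equiv (Quotient.exact hY.symm)
  | one => exact fun Y hY => hasEnergy_point.of_equiv (Quotient.exact hY.symm)
  | add a b _ _ iha ihb =>
    intro Y hY
    induction a using Quotient.inductionOn with | h A =>
    induction b using Quotient.inductionOn with | h B =>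
    exact ((iha A rfl).sum (ihb B rfl)).of_equiv (Quotient.exact hY.symm)
  | mul a b _ _ iha ihb =>
    intro Y hY
    induction a using Quotient.inductionOn with | h A =>
    induction b using Quotient.inductionOn with | h B =>
    exact ((iha A rfl).prod (ihb B rfl)).of_equiv (Quotient.exact hY.symm)

end CellComplex

/-! ### Signed complexes -/

open Algebra.GrothendieckAddGroup in
theorem exists_sub_of_mem_strongRing {r : CellRing} (hr : r ∈ strongRing) :
    ∃ a ∈ Subsemiring.closure CellClass.simplicial,
      ∃ b ∈ Subsemiring.closure CellClass.simplicial, of a - of b = r := by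
  have hone : (of 1 : CellRing) = 1 := rfl
  have hmul : ∀ a b : CellClass, (of (a * b) : CellRing) = of a * of b :=
    fun a b => (of_mul_of a b).symm
  induction hr using Subring.closure_induction with
  | mem x hx =>
    obtain ⟨a, ha, rfl⟩ := hx
    exact ⟨a, Subsemiring.subset_closure ha, 0, zero_mem _, by simp⟩
  | zero => exact ⟨0, zero_mem _, 0, zero_mem _, by simp⟩
  | one => exact ⟨1, one_mem _, 0, zero_mem _, by simp [hone]⟩
  | add x y _ _ hx hy =>
    obtain ⟨a, ha, b, hb, rfl⟩ := hx
    obtain ⟨c, hc, d, hd, rfl⟩ := hy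
    exact ⟨a + c, add_mem ha hc, b + d, add_mem hb hd, by simp only [map_add]; abel⟩
  | neg x _ hx =>
    obtain ⟨a, ha, b, hb, rfl⟩ := hx
    exact ⟨b, hb, a, ha, by abel⟩
  | mul x y _ _ hx hy =>
    obtain ⟨a, ha, b, hb, rfl⟩ := hx
    obtain ⟨c, hc, d, hd, rfl⟩ := hy
    -- Expand (a - b)(c - d) and collect the positive and the negative terms.
    exact ⟨a * c + b * d, add_mem (mul_mem ha hc) (mul_mem hb hd), a * d + b * c,
      add_mem (mul_mem ha hd) (mul_mem hb hc), by simp only [map_add, hmul]; ring⟩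

namespace SignedComplex

theorem exists_toRing_eq {r : CellRing} (hr : r ∈ strongRing) :
    ∃ G : SignedComplex, G.toRing = r := by
  obtain ⟨a, ha, b, hb, h⟩ := exists_sub_of_mem_strongRing hr
  induction a using Quotient.inductionOn with | h P =>
  induction b using Quotient.inductionOn with | h N =>
  exact ⟨⟨P, N, ha, hb⟩, h⟩

theorem exists_mul_eq_one (G : SignedComplex) [DecidableEq G.Cell] :
    ∃ g : Matrix G.Cell G.Cell ℤ, G.connectionLaplacian * g = 1 ∧
      ∑ x, ∑ y, g x y = CellRing.eulerChar G.toRing := by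
  classical
  obtain ⟨g, hg, hgs⟩ := G.isStrong_pos.hasEnergy
  obtain ⟨g', hg', hgs'⟩ := G.isStrong_neg.hasEnergy
  -- The inverse of -L(N) is -g', so the negative part contributes -χ(N) to the energy.
  refine ⟨Matrix.fromBlocks g 0 0 (-g'), ?_, ?_⟩
  · ext x y
    rw [Matrix.mul_apply, Fintype.sum_sum_type, Matrix.one_apply]
    rcases x with x | x <;> rcases y with y | y <;>
      simp only [connectionLaplacian, Matrix.fromBlocks_apply₁₁, Matrix.fromBlocks_apply₁₂,
        Matrix.fromBlocks_apply₂₁, Matrix.fromBlocks_apply₂₂, Matrix.zero_apply, Matrix.neg_apply,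
        mul_zero, zero_mul, neg_mul_neg, Finset.sum_const_zero, add_zero, zero_add, hg, hg',
        reduceCtorEq, if_false]
    · exact if_congr Sum.inl_injective.eq_iff.symm rfl rfl
    · exact if_congr Sum.inr_injective.eq_iff.symm rfl rfl
  · rw [toRing, map_sub, CellRing.eulerChar_ofComplex, CellRing.eulerChar_ofComplex, ← hgs, ← hgs']
    simp [Fintype.sum_sum_type, sub_eq_add_neg]

end SignedComplex

open Classical in
theorem mainTheorem2 (r : CellRing) (hr : r ∈ strongRing) :
    (∃ G : SignedComplex, G.toRing = r) ∧
    ∀ G : SignedComplex, G.toRing = r →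
      (G.connectionLaplacian.det = 1 ∨ G.connectionLaplacian.det = -1) ∧
      (∑ x, ∑ y, G.connectionLaplacian⁻¹ x y = CellRing.eulerChar r) ∧
      G.negate.toRing = -r ∧
      G.negate.connectionLaplacian =
        (-G.connectionLaplacian).submatrix (Equiv.sumComm _ _) (Equiv.sumComm _ _) := by
  refine ⟨SignedComplex.exists_toRing_eq hr, ?_⟩
  rintro G rfl
  obtain ⟨g, hg, hgs⟩ := G.exists_mul_eq_one
  refine ⟨?_, ?_, ?_, ?_⟩
  · refine Int.isUnit_iff.1 (IsUnit.of_mul_eq_one g.det ?_)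
    rw [← Matrix.det_mul, hg, Matrix.det_one]
  · rw [Matrix.inv_eq_right_inv hg, hgs]
  · exact (neg_sub _ _).symm
  · ext (x | x) (y | y)
    · exact (neg_neg _).symm
    · exact neg_zero.symm
    · exact neg_zero.symm
    · rfl
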